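/- **Theorem (Irreducibility).** Let $X$ be a compact Hausdorff space, let $\sigma : X \to X$ be a homeomorphism, and let $\alpha(f) = f\circ\sigma^{-1}$ for $f \in C(X)$ (continuous complex-valued functions with the supremum norm). Let $$\ell^1(\Sigma) = \Big\{a : \mathbb Z \to C(X) : \|a\| := \sum_{n\in\mathbb Z}\|a(n)\| < \infty\Big\}$$ be the unital complex Banach algebra with the twisted convolution product $$(aa')(n) = \sum_{k\in\mathbb Z} a(k)\cdot\alpha^k(a'(n-k)).$$ Let $x \in X$ be an aperiodic point, i.e. $\sigma^n x \neq x$ for all integers $n \ge 1$, and let $p \in [1,\infty]$. Let $S$ be the right shift $(Sv)_k = v_{k-1}$ on the complex sequence space $\ell^p(\mathbb Z)$, for $f \in C(X)$ let $\pi_x^p(f)$ be the operator on $\ell^p(\mathbb Z)$ with $(\pi_x^p(f)v)_k = f(\sigma^k x)\,v_k$, and let $$\pi_x^p : \ell^1(\Sigma) \to \mathcal B(\ell^p(\mathbb Z)),\qquad \pi_x^p(a) = \sum_{n\in\mathbb Z}\pi_x^p(a(n))\,S^n$$ be the resulting representation, the series being absolutely convergent in the operator norm. A representation $\pi$ of an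 algebra $A$ by bounded operators on a normed space $E$ is called *algebraically irreducible* if $\pi(A)(E) \neq \{0\}$ and the only invariant linear subspaces of $E$ are $\{0\}$ and $E$; it is called *topologically irreducible* if $\pi(A)(E)\neq\{0\}$ and the only closed invariant linear subspaces of $E$ are $\{0\}$ and $E$. Then $\pi_x^p$ is unital and contractive (that is, $\|\pi_x^p(a)\| \le \|a\|$ for all $a\in\ell^1(\Sigma)$), and it is: 1. algebraically irreducible if $p = 1$; 2. not algebraically irreducible, but still topologically irreducible, if $p \in (1,\infty)$; 3. not topologically irreducible if $p = \infty$. If $p \in [1,\infty)$, then the commutant of $\pi_x^p(\ell^1(\Sigma))$ in $\mathcal B(\ell^p(\mathbb Z))$ equals the set of complex multiples of the identity operator. -/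

import Mathlib

open scoped ENNReal

noncomputable section

namespace DynSys

/-! ### The Banach algebra `ℓ¹(Σ)` of a topological dynamical system `Σ = (X, σ)` -/

section Action

variable {X : Type*} [TopologicalSpace X]

/-- The automorphism `α(f) = f ∘ σ⁻¹` of `C(X)` induced by the homeomorphism `σ`. -/
def alpha (σ : X ≃ₜ X) : C(X, ℂ) ≃ₐ[ℂ] C(X, ℂ) where
  toFun f := f.comp (σ⁻¹ : X ≃ₜ X)
  invFun f := f.comp (σ : X ≃ₜ X)
  left_inv f := by ext y; simp
  right_inv f := by ext y; simp
  map_mul' f g := rfl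
  map_add' f g := rfl
  commutes' c := rfl

theorem alpha_apply (σ : X ≃ₜ X) (f : C(X, ℂ)) (y : X) : alpha σ f y = f (σ⁻¹ y) := rfl

theorem alpha_inv_apply (σ : X ≃ₜ X) (f : C(X, ℂ)) (y : X) : (alpha σ)⁻¹ f y = f (σ y) := rfl

theorem alpha_zpow_apply (σ : X ≃ₜ X) (n : ℤ) (f : C(X, ℂ)) (y : X) :
    (alpha σ ^ n) f y = f ((σ ^ (-n)) y) := by
  induction n generalizing f y with
  | zero => simp
  | succ n ih =>
    rw [zpow_add_one, AlgEquiv.mul_apply, ih, alpha_apply, ← Homeomorph.mul_apply, ← zpow_neg_one,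
      ← zpow_add]
    congr 3
    ring
  | pred n ih =>
    rw [zpow_sub_one, AlgEquiv.mul_apply, ih, alpha_inv_apply, ← Homeomorph.mul_apply,
      ← zpow_one_add]
    congr 3
    ring

end Action

section Algebra

variable {X : Type*} [TopologicalSpace X] [CompactSpace X]

theorem norm_alpha_zpow_le (σ : X ≃ₜ X) (n : ℤ) (f : C(X, ℂ)) : ‖(alpha σ ^ n) f‖ ≤ ‖f‖ := by
  rw [ContinuousMap.norm_le _ (norm_nonneg f)]
  intro y
  rw [alpha_zpow_apply]
  exact f.norm_coe_le_norm _

/-- `α ^ n` as a continuous linear map on `C(X)`. -/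
def alphaCLM (σ : X ≃ₜ X) (n : ℤ) : C(X, ℂ) →L[ℂ] C(X, ℂ) :=
  LinearMap.mkContinuous (alpha σ ^ n).toLinearMap 1 fun f => by
    simpa using norm_alpha_zpow_le σ n f

theorem alphaCLM_apply (σ : X ≃ₜ X) (n : ℤ) (f : C(X, ℂ)) :
    alphaCLM σ n f = (alpha σ ^ n) f := rfl

/-- The space `ℓ¹(Σ) = ℓ¹(ℤ, C(X))` of absolutely summable functions `a : ℤ → C(X)`, with norm
`‖a‖ = ∑ n, ‖a n‖`; the homeomorphism `σ` enters through the multiplication. -/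
def L1Sigma (_σ : X ≃ₜ X) : Type _ := lp (fun _ : ℤ => C(X, ℂ)) 1

namespace L1Sigma

variable {σ : X ≃ₜ X}

instance : NormedAddCommGroup (L1Sigma σ) :=
  inferInstanceAs (NormedAddCommGroup (lp (fun _ : ℤ => C(X, ℂ)) 1))

instance : NormedSpace ℂ (L1Sigma σ) :=
  inferInstanceAs (NormedSpace ℂ (lp (fun _ : ℤ => C(X, ℂ)) 1))

instance : CompleteSpace (L1Sigma σ) :=
  inferInstanceAs (CompleteSpace (lp (fun _ : ℤ => C(X, ℂ)) 1))

/-- An element of `ℓ¹(Σ)` is a function `ℤ → C(X)`. -/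
instance : FunLike (L1Sigma σ) ℤ C(X, ℂ) where
  coe a := Subtype.val (p := fun f => f ∈ lp (fun _ : ℤ => C(X, ℂ)) 1) a
  coe_injective _ _ h := Subtype.ext h

@[ext]
theorem ext {a b : L1Sigma σ} (h : ∀ n, a n = b n) : a = b :=
  DFunLike.ext a b h

theorem add_apply (a b : L1Sigma σ) (n : ℤ) : (a + b) n = a n + b n := rfl

theorem zero_apply (n : ℤ) : (0 : L1Sigma σ) n = 0 := rfl

theorem smul_apply (c : ℂ) (a : L1Sigma σ) (n : ℤ) : (c • a) n = c • a n := rfl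

theorem summable_norm (a : L1Sigma σ) : Summable fun n => ‖a n‖ := by
  have h : Summable fun n => ‖a n‖ ^ (1 : ℝ≥0∞).toReal :=
    (lp.memℓp (p := 1) (E := fun _ : ℤ => C(X, ℂ)) a).summable (by simp)
  simpa using h

theorem norm_def (a : L1Sigma σ) : ‖a‖ = ∑' n, ‖a n‖ := by
  have h : ‖a‖ = (∑' n, ‖a n‖ ^ (1 : ℝ≥0∞).toReal) ^ (1 / (1 : ℝ≥0∞).toReal) :=
    lp.norm_eq_tsum_rpow (p := 1) (E := fun _ : ℤ => C(X, ℂ)) (by simp) a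
  simpa using h

/-- The element of `ℓ¹(Σ)` given by an absolutely summable family. -/
def mk (f : ℤ → C(X, ℂ)) (h : Summable fun n => ‖f n‖) : L1Sigma σ :=
  ⟨f, memℓp_gen (by simpa using h)⟩

theorem mk_apply (f : ℤ → C(X, ℂ)) (h : Summable fun n => ‖f n‖) (n : ℤ) :
    (mk f h : L1Sigma σ) n = f n := rfl

theorem norm_apply_le (a : L1Sigma σ) (n : ℤ) : ‖a n‖ ≤ ‖a‖ := by
  rw [norm_def]
  exact a.summable_norm.le_tsum n fun _ _ => norm_nonneg _

/-- The change of variables `(n, k) ↦ (k, n - k)` on `ℤ × ℤ`. -/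
def convEquiv : ℤ × ℤ ≃ ℤ × ℤ where
  toFun q := (q.2, q.1 - q.2)
  invFun q := (q.1 + q.2, q.1)
  left_inv q := by ext <;> simp
  right_inv q := by ext <;> simp

theorem convEquiv_apply (q : ℤ × ℤ) : convEquiv q = (q.2, q.1 - q.2) := rfl

theorem norm_term_le (a b : L1Sigma σ) (k m : ℤ) :
    ‖a k * (alpha σ ^ k) (b m)‖ ≤ ‖a k‖ * ‖b m‖ :=
  (norm_mul_le _ _).trans (mul_le_mul_of_nonneg_left (norm_alpha_zpow_le σ k _) (norm_nonneg _))

theorem summable_norm_prod (a b : L1Sigma σ) :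
    Summable fun q : ℤ × ℤ => ‖a q.1‖ * ‖b q.2‖ :=
  a.summable_norm.mul_of_nonneg b.summable_norm (fun _ => norm_nonneg _) fun _ => norm_nonneg _

theorem summable_norm_conv' (a b : L1Sigma σ) :
    Summable fun q : ℤ × ℤ => ‖a q.2‖ * ‖b (q.1 - q.2)‖ := by
  have h := (a.summable_norm_prod b).comp_injective convEquiv.injective
  simpa only [Function.comp_def, convEquiv_apply] using h

theorem summable_norm_conv (a b : L1Sigma σ) :
    Summable fun q : ℤ × ℤ => ‖a q.2 * (alpha σ ^ q.2) (b (q.1 - q.2))‖ :=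
  (a.summable_norm_conv' b).of_nonneg_of_le (fun _ => norm_nonneg _)
    fun q => norm_term_le a b q.2 (q.1 - q.2)

theorem summable_norm_fiber (a b : L1Sigma σ) (n : ℤ) :
    Summable fun k : ℤ => ‖a k * (alpha σ ^ k) (b (n - k))‖ :=
  (a.summable_norm_conv b).prod_factor n

theorem summable_fiber (a b : L1Sigma σ) (n : ℤ) :
    Summable fun k : ℤ => a k * (alpha σ ^ k) (b (n - k)) :=
  (a.summable_norm_fiber b n).of_norm

theorem summable_norm_mul (a b : L1Sigma σ) :
    Summable fun n : ℤ => ‖∑' k : ℤ, a k * (alpha σ ^ k) (b (n - k))‖ :=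
  (a.summable_norm_conv b).prod.of_nonneg_of_le (fun _ => norm_nonneg _)
    fun n => norm_tsum_le_tsum_norm (a.summable_norm_fiber b n)

/-- Twisted convolution: `(a a') n = ∑ k, a k * α ^ k (a' (n - k))`. -/
instance : Mul (L1Sigma σ) :=
  ⟨fun a b => mk (fun n => ∑' k : ℤ, a k * (alpha σ ^ k) (b (n - k))) (a.summable_norm_mul b)⟩

theorem mul_apply (a b : L1Sigma σ) (n : ℤ) :
    (a * b) n = ∑' k : ℤ, a k * (alpha σ ^ k) (b (n - k)) := rfl

/-- The element `f δ ^ n` of `ℓ¹(Σ)`: the function on `ℤ` with value `f` at `n` and `0`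
elsewhere. -/
def single (n : ℤ) (f : C(X, ℂ)) : L1Sigma σ :=
  mk (Pi.single n f) (summable_of_ne_finset_zero (s := {n}) fun m hm => by
    rw [Pi.single_eq_of_ne (by simpa using hm), norm_zero])

theorem single_apply (n m : ℤ) (f : C(X, ℂ)) :
    (single n f : L1Sigma σ) m = if m = n then f else 0 := Pi.single_apply n f m

/-- The identity element of `ℓ¹(Σ)` is `χ_{0}`. -/
instance : One (L1Sigma σ) := ⟨single 0 1⟩

theorem one_apply (n : ℤ) : (1 : L1Sigma σ) n = if n = 0 then 1 else 0 := single_apply 0 n 1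

theorem norm_mul_le' (a b : L1Sigma σ) : ‖a * b‖ ≤ ‖a‖ * ‖b‖ := by
  calc ‖a * b‖ = ∑' n : ℤ, ‖∑' k : ℤ, a k * (alpha σ ^ k) (b (n - k))‖ := norm_def _
    _ ≤ ∑' n : ℤ, ∑' k : ℤ, ‖a k‖ * ‖b (n - k)‖ := by
        refine (a.summable_norm_mul b).tsum_le_tsum (fun n => ?_) (a.summable_norm_conv' b).prod
        exact (norm_tsum_le_tsum_norm (a.summable_norm_fiber b n)).trans
          ((a.summable_norm_fiber b n).tsum_le_tsum (fun k => norm_term_le a b k (n - k))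
            ((a.summable_norm_conv' b).prod_factor n))
    _ = ∑' q : ℤ × ℤ, ‖a q.2‖ * ‖b (q.1 - q.2)‖ := (a.summable_norm_conv' b).tsum_prod.symm
    _ = ∑' q : ℤ × ℤ, ‖a q.1‖ * ‖b q.2‖ := by
        rw [← convEquiv.tsum_eq fun q : ℤ × ℤ => ‖a q.1‖ * ‖b q.2‖]
        simp only [convEquiv_apply]
    _ = ‖a‖ * ‖b‖ := by
        rw [(a.summable_norm_prod b).tsum_prod, norm_def a, norm_def b, ← tsum_mul_right]
        exact tsum_congr fun k => b.summable_norm.tsum_mul_left ‖a k‖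

theorem mul_assoc' (a b c : L1Sigma σ) : a * b * c = a * (b * c) := by
  ext1 n
  have hG : Summable fun q : ℤ × ℤ =>
      a q.2 * (alpha σ ^ q.2) (b (q.1 - q.2)) * (alpha σ ^ q.1) (c (n - q.1)) := by
    refine Summable.of_norm_bounded ((a.summable_norm_conv b).mul_right ‖c‖) fun q => ?_
    refine (norm_mul_le _ _).trans (mul_le_mul_of_nonneg_left ?_ (norm_nonneg _))
    exact (norm_alpha_zpow_le σ _ _).trans (norm_apply_le c _)
  have h1 : ∀ k : ℤ, (a * b) k * (alpha σ ^ k) (c (n - k)) =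
      ∑' j : ℤ, a j * (alpha σ ^ j) (b (k - j)) * (alpha σ ^ k) (c (n - k)) := fun k => by
    rw [mul_apply, (a.summable_fiber b k).tsum_mul_right]
  have h2 : ∀ j : ℤ, a j * (alpha σ ^ j) ((b * c) (n - j)) =
      ∑' k : ℤ, a j * (alpha σ ^ j) (b (k - j)) * (alpha σ ^ k) (c (n - k)) := fun j => by
    have hs := b.summable_fiber c (n - j)
    rw [mul_apply, ← alphaCLM_apply, (alphaCLM σ j).map_tsum hs,
      ← ((alphaCLM σ j).summable hs).tsum_mul_left, ← (Equiv.subRight j).tsum_eq]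
    refine tsum_congr fun k => ?_
    simp only [Equiv.subRight_apply, alphaCLM_apply, map_mul]
    rw [← AlgEquiv.mul_apply (alpha σ ^ j), ← zpow_add, mul_assoc]
    congr 4 <;> ring_nf
  rw [mul_apply, mul_apply, tsum_congr h1, tsum_congr h2]
  exact (Summable.tsum_comm (f := fun k j : ℤ =>
    a j * (alpha σ ^ j) (b (k - j)) * (alpha σ ^ k) (c (n - k))) hG).symm

theorem one_mul' (a : L1Sigma σ) : 1 * a = a := by
  ext1 n
  rw [mul_apply, tsum_eq_single 0 fun k hk => by rw [one_apply, if_neg hk, zero_mul]]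
  simp [one_apply]

theorem mul_one' (a : L1Sigma σ) : a * 1 = a := by
  ext1 n
  rw [mul_apply, tsum_eq_single n fun k hk => by
    rw [one_apply, if_neg (sub_ne_zero.2 hk.symm), map_zero, mul_zero]]
  simp [one_apply]

theorem mul_add' (a b c : L1Sigma σ) : a * (b + c) = a * b + a * c := by
  ext1 n
  rw [add_apply, mul_apply, mul_apply, mul_apply,
    ← (a.summable_fiber b n).tsum_add (a.summable_fiber c n)]
  exact tsum_congr fun k => by rw [add_apply, map_add, mul_add]

theorem add_mul' (a b c : L1Sigma σ) : (a + b) * c = a * c + b * c := by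
  ext1 n
  rw [add_apply, mul_apply, mul_apply, mul_apply,
    ← (a.summable_fiber c n).tsum_add (b.summable_fiber c n)]
  exact tsum_congr fun k => by rw [add_apply, add_mul]

theorem smul_mul' (r : ℂ) (a b : L1Sigma σ) : r • a * b = r • (a * b) := by
  ext1 n
  rw [smul_apply, mul_apply, mul_apply, ← (a.summable_fiber b n).tsum_const_smul]
  exact tsum_congr fun k => by rw [smul_apply, smul_mul_assoc]

theorem mul_smul' (r : ℂ) (a b : L1Sigma σ) : a * r • b = r • (a * b) := by
  ext1 n
  rw [smul_apply, mul_apply, mul_apply, ← (a.summable_fiber b n).tsum_const_smul]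
  exact tsum_congr fun k => by rw [smul_apply, map_smul, mul_smul_comm]

instance : NormedRing (L1Sigma σ) where
  __ := (inferInstance : NormedAddCommGroup (L1Sigma σ))
  mul_assoc := mul_assoc'
  one_mul := one_mul'
  mul_one := mul_one'
  left_distrib := mul_add'
  right_distrib := add_mul'
  zero_mul a := by
    ext1 n
    rw [mul_apply]
    simp [zero_apply]
  mul_zero a := by
    ext1 n
    rw [mul_apply]
    simp [zero_apply]
  norm_mul_le := norm_mul_le'

instance : Algebra ℂ (L1Sigma σ) := Algebra.ofModule smul_mul' mul_smul'

instance : NormedAlgebra ℂ (L1Sigma σ) where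
  norm_smul_le := norm_smul_le

end L1Sigma

end Algebra

/-! ### Representations and irreducibility -/

section Representations

variable {A E : Type*} [NonUnitalRing A] [Module ℂ A] [NormedAddCommGroup E] [NormedSpace ℂ E]

/-- `L` is an invariant subspace for the normed representation `π` of `A` on `E`. -/
def IsInvariant (π : A →ₙₐ[ℂ] (E →L[ℂ] E)) (L : Submodule ℂ E) : Prop :=
  ∀ a : A, ∀ v ∈ L, π a v ∈ L

/-- `π` is algebraically irreducible: `π(A)(E) ≠ {0}`, and `{0}` and `E` are the only invariant
subspaces of `E`. -/
def IsAlgebraicallyIrreducible (π : A →ₙₐ[ℂ] (E →L[ℂ] E)) : Prop :=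
  (∃ a : A, ∃ v : E, π a v ≠ 0) ∧
    ∀ L : Submodule ℂ E, IsInvariant π L → L = ⊥ ∨ L = ⊤

/-- `π` is topologically irreducible: `π(A)(E) ≠ {0}`, and `{0}` and `E` are the only closed
invariant subspaces of `E`. -/
def IsTopologicallyIrreducible (π : A →ₙₐ[ℂ] (E →L[ℂ] E)) : Prop :=
  (∃ a : A, ∃ v : E, π a v ≠ 0) ∧
    ∀ L : Submodule ℂ E, IsClosed (L : Set E) → IsInvariant π L → L = ⊥ ∨ L = ⊤

end Representations

/-! ### The representations `π_x^p` of `ℓ¹(Σ)` on `ℓ^p(ℤ)` -/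

section Rep

/-- The two-sided sequence space `ℓ^p(ℤ)` of complex sequences. -/
abbrev LpZ (p : ℝ≥0∞) : Type := lp (fun _ : ℤ => ℂ) p

variable (p : ℝ≥0∞) [Fact (1 ≤ p)]

theorem memℓp_comp_equiv (e : ℤ ≃ ℤ) {v : ℤ → ℂ} (hv : Memℓp v p) :
    Memℓp (fun k => v (e k)) p := by
  rcases eq_or_ne p ∞ with rfl | hp
  · obtain ⟨C, hC⟩ := memℓp_infty_iff.1 hv
    refine memℓp_infty ⟨C, ?_⟩
    rintro _ ⟨k, rfl⟩
    exact hC ⟨e k, rfl⟩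
  · have hp0 : 0 < p.toReal :=
      ENNReal.toReal_pos (zero_lt_one.trans_le (Fact.out : 1 ≤ p)).ne' hp
    exact memℓp_gen ((hv.summable hp0).comp_injective e.injective)

theorem norm_comp_equiv (e : ℤ ≃ ℤ) (v w : LpZ p) (h : ∀ k, w k = v (e k)) : ‖w‖ = ‖v‖ := by
  rcases eq_or_ne p ∞ with rfl | hp
  · rw [lp.norm_eq_ciSup, lp.norm_eq_ciSup, ← e.iSup_comp (g := fun i => ‖v i‖)]
    simp only [h]
  · have hp0 : 0 < p.toReal :=
      ENNReal.toReal_pos (zero_lt_one.trans_le (Fact.out : 1 ≤ p)).ne' hp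
    rw [lp.norm_eq_tsum_rpow hp0, lp.norm_eq_tsum_rpow hp0,
      ← e.tsum_eq fun i => ‖v i‖ ^ p.toReal]
    simp only [h]

/-- The right shift `S` on `ℓ^p(ℤ)`, `(S v) k = v (k - 1)`, so that `S e_k = e_{k+1}`. It is an
invertible isometry. -/
def shift : LpZ p ≃ₗᵢ[ℂ] LpZ p where
  toFun v := ⟨fun k => v (k - 1), memℓp_comp_equiv p (Equiv.subRight 1) (lp.memℓp v)⟩
  invFun v := ⟨fun k => v (k + 1), memℓp_comp_equiv p (Equiv.addRight 1) (lp.memℓp v)⟩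
  map_add' _ _ := rfl
  map_smul' _ _ := rfl
  left_inv v := by ext k; simp
  right_inv v := by ext k; simp
  norm_map' v := norm_comp_equiv p (Equiv.subRight 1) v _ fun _ => rfl

theorem shift_apply (v : LpZ p) (k : ℤ) : shift p v k = v (k - 1) := rfl

theorem shift_inv_apply (v : LpZ p) (k : ℤ) : (shift p)⁻¹ v k = v (k + 1) := rfl

theorem shift_zpow_apply (n : ℤ) (v : LpZ p) (k : ℤ) : (shift p ^ n) v k = v (k - n) := by
  induction n generalizing v k with
  | zero => simp
  | succ n ih =>
    rw [zpow_add_one, LinearIsometryEquiv.coe_mul, Function.comp_apply, ih, shift_apply]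
    exact congrArg (Subtype.val (p := fun f => f ∈ lp (fun _ : ℤ => ℂ) p) v) (by ring)
  | pred n ih =>
    rw [zpow_sub_one, LinearIsometryEquiv.coe_mul, Function.comp_apply, ih, shift_inv_apply]
    exact congrArg (Subtype.val (p := fun f => f ∈ lp (fun _ : ℤ => ℂ) p) v) (by ring)

/-- `S ^ n`, for `n : ℤ`, as a bounded operator on `ℓ^p(ℤ)`. -/
def shiftPow (n : ℤ) : LpZ p →L[ℂ] LpZ p :=
  ((shift p ^ n : LpZ p ≃ₗᵢ[ℂ] LpZ p) : LpZ p →L[ℂ] LpZ p)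

theorem shiftPow_apply (n : ℤ) (v : LpZ p) (k : ℤ) : shiftPow p n v k = v (k - n) :=
  shift_zpow_apply p n v k

theorem norm_shiftPow_le (n : ℤ) : ‖shiftPow p n‖ ≤ 1 :=
  ContinuousLinearMap.opNorm_le_bound _ zero_le_one fun v => by
    rw [one_mul]
    exact ((shift p ^ n).norm_map v).le

variable {X : Type*} [TopologicalSpace X] [CompactSpace X] (σ : X ≃ₜ X) (x : X)

/-- For `f ∈ C(X)`, the operator `π_x^p(f)` on `ℓ^p(ℤ)` that multiplies the `k`-th coordinate of a
sequence by `f (σ ^ k x)`. -/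
def mulOp (f : C(X, ℂ)) : LpZ p →L[ℂ] LpZ p :=
  lp.mapCLM p (fun k : ℤ => f ((σ ^ k) x) • ContinuousLinearMap.id ℂ ℂ) (norm_nonneg f) fun k => by
    rw [norm_smul, ContinuousLinearMap.norm_id, mul_one]
    exact f.norm_coe_le_norm _

theorem mulOp_apply (f : C(X, ℂ)) (v : LpZ p) (k : ℤ) :
    mulOp p σ x f v k = f ((σ ^ k) x) * v k := rfl

theorem norm_mulOp_le (f : C(X, ℂ)) : ‖mulOp p σ x f‖ ≤ ‖f‖ :=
  lp.norm_mapCLM_le p _ _ _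

theorem norm_repTerm_le (f : C(X, ℂ)) (n : ℤ) : ‖mulOp p σ x f * shiftPow p n‖ ≤ ‖f‖ :=
  (norm_mul_le _ _).trans <| (mul_le_mul (norm_mulOp_le p σ x f) (norm_shiftPow_le p n)
    (norm_nonneg _) (norm_nonneg _)).trans_eq (mul_one _)

variable {σ} in
theorem summable_norm_repTerm (a : L1Sigma σ) :
    Summable fun n : ℤ => ‖mulOp p σ x (a n) * shiftPow p n‖ :=
  a.summable_norm.of_nonneg_of_le (fun _ => norm_nonneg _) fun n => norm_repTerm_le p σ x (a n) n

variable {σ} in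
theorem summable_repTerm (a : L1Sigma σ) :
    Summable fun n : ℤ => mulOp p σ x (a n) * shiftPow p n :=
  (summable_norm_repTerm p x a).of_norm

/-- The covariance relation `S ^ k π(f) = π(α ^ k f) S ^ k`, in the form in which it is used for
the multiplicativity of the representation. -/
theorem repTerm_mul (f g : C(X, ℂ)) (k m : ℤ) :
    mulOp p σ x f * shiftPow p k * (mulOp p σ x g * shiftPow p m) =
      mulOp p σ x (f * (alpha σ ^ k) g) * shiftPow p (k + m) := by
  ext v j
  simp only [mul_apply_eq_comp, mulOp_apply, shiftPow_apply, ContinuousMap.mul_apply,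
    alpha_zpow_apply]
  rw [← Homeomorph.mul_apply, ← zpow_add, sub_add_eq_sub_sub, neg_add_eq_sub, mul_assoc]

/-- `f ↦ π_x^p(f) S ^ n` as a continuous linear map. -/
def repTermCLM (n : ℤ) : C(X, ℂ) →L[ℂ] (LpZ p →L[ℂ] LpZ p) :=
  LinearMap.mkContinuous
    { toFun := fun f => mulOp p σ x f * shiftPow p n
      map_add' := fun f g => by
        ext v j
        simp only [mul_apply_eq_comp, _root_.add_apply, lp.coeFn_add,
          Pi.add_apply, mulOp_apply, ContinuousMap.add_apply, add_mul]
      map_smul' := fun c f => by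
        ext v j
        simp only [mul_apply_eq_comp, _root_.smul_apply, lp.coeFn_smul,
          Pi.smul_apply, mulOp_apply, ContinuousMap.smul_apply, smul_eq_mul, mul_assoc,
          RingHom.id_apply] }
    1 fun f => by simpa using norm_repTerm_le p σ x f n

theorem repTermCLM_apply (n : ℤ) (f : C(X, ℂ)) :
    repTermCLM p σ x n f = mulOp p σ x f * shiftPow p n := rfl

/-- The representation `π_x^p` of `ℓ¹(Σ)` on `ℓ^p(ℤ)`, for a point `x` of `X`:
`π_x^p(∑ n, f_n δ ^ n) = ∑ n, π_x^p(f_n) S ^ n`, an absolutely convergent series in the operator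
norm. -/
def rep : L1Sigma σ →ₙₐ[ℂ] (LpZ p →L[ℂ] LpZ p) where
  toFun a := ∑' n : ℤ, mulOp p σ x (a n) * shiftPow p n
  map_smul' c a := by
    simp only [MonoidHom.id_apply, ← repTermCLM_apply, L1Sigma.smul_apply, map_smul]
    exact (summable_repTerm p x a).tsum_const_smul c
  map_zero' := by
    simp only [← repTermCLM_apply, L1Sigma.zero_apply, map_zero, tsum_zero]
  map_add' a b := by
    simp only [← repTermCLM_apply, L1Sigma.add_apply, map_add]
    exact (summable_repTerm p x a).tsum_add (summable_repTerm p x b)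
  map_mul' a b := by
    have hF := summable_mul_of_summable_norm (summable_norm_repTerm p x a)
      (summable_norm_repTerm p x b)
    have hF' := (L1Sigma.convEquiv.summable_iff).2 hF
    rw [(summable_repTerm p x a).tsum_mul_tsum (summable_repTerm p x b) hF]
    refine Eq.trans ?_ (hF'.tsum_prod.symm.trans (L1Sigma.convEquiv.tsum_eq
      fun q : ℤ × ℤ => mulOp p σ x (a q.1) * shiftPow p q.1 *
        (mulOp p σ x (b q.2) * shiftPow p q.2)))
    refine tsum_congr fun n => ?_
    rw [← repTermCLM_apply, L1Sigma.mul_apply, (repTermCLM p σ x n).map_tsum (a.summable_fiber b n)]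
    refine tsum_congr fun k => ?_
    simp only [L1Sigma.convEquiv_apply, Function.comp_apply, repTermCLM_apply, repTerm_mul]
    rw [add_sub_cancel]

end Rep

end DynSys

end

noncomputable section

namespace DynSys

/-! ### Separation of points on an aperiodic orbit. -/

section Orbit

variable {X : Type*} {x : X}

/-! Write `e_k` for the unit coordinate vectors. The `k`-th coordinate of `π(a) e_0` is `a k (σ ^ k
x)`, so the cyclic subspace generated by `e_0` consists of absolutely summable sequences
(`summable_norm_orbitMap`). For `1 < p < ∞` it is therefore a proper invariant subspace, and for `p
= ∞` its closure lies in `c_0`, so it is proper too.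

Conversely, aperiodicity and Urysohn's lemma give `f` with `‖f‖ ≤ 1` that is `1` at one orbit point
and `0` at finitely many others. For `p < ∞` the vectors `π(f) v` then come arbitrarily close to
`v_k e_k` (`exists_norm_mulOp_sub_lpSingle_lt`). A nonzero closed invariant subspace thus contains
some `e_k`, by shifting all of them, and so is everything. For `p = 1` no closure is needed: a small
error has the form `π(b) (v_k e_k)` with `‖b‖ < 1` (`exists_rep_lpSingle_eq`), and `1 + b` is
invertible in the Banach algebra.

An operator in the commutant has `e_0` as an eigenvector by the same separation, and the shifts
carry its eigenvalue to every `e_j`. -/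

theorem orbit_injective [TopologicalSpace X] {σ : X ≃ₜ X} (hx : x ∉ Function.periodicPts σ) :
    Function.Injective fun k : ℤ => (σ ^ k) x := by
  have key : ∀ (n : ℕ) (k : ℤ), 0 < n → (σ ^ (k + n)) x ≠ (σ ^ k) x := by
    intro n k hn h
    refine hx (Function.mk_mem_periodicPts hn ?_)
    have h' : (σ ^ n) x = x := by
      rw [zpow_add, Homeomorph.mul_apply, zpow_natCast] at h
      exact (σ ^ k).injective h
    have hpow : ∀ (m : ℕ) (y : X), (σ ^ m) y = (σ^[m]) y := by
      intro m
      induction m with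
      | zero => intro y; rfl
      | succ m ih =>
        intro y
        rw [pow_succ, Homeomorph.mul_apply, ih, Function.iterate_succ_apply]
    rw [Function.IsPeriodicPt, Function.IsFixedPt, ← hpow, h']
  intro j k h
  rcases lt_trichotomy j k with hjk | hjk | hjk
  · refine absurd h.symm ?_
    have := key (k - j).toNat j (by omega)
    rwa [Int.toNat_of_nonneg (by omega), add_sub_cancel] at this
  · exact hjk
  · refine absurd h ?_
    have := key (j - k).toNat k (by omega)
    rwa [Int.toNat_of_nonneg (by omega), add_sub_cancel] at this

/-- Finitely many other points of an aperiodic orbit can be separated from a given one by a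
continuous function of norm at most `1`. -/
theorem exists_norm_le_one_of_finset [TopologicalSpace X] [CompactSpace X] [T2Space X]
    {σ : X ≃ₜ X} (hx : x ∉ Function.periodicPts σ) (k : ℤ) (F : Finset ℤ) :
    ∃ f : C(X, ℂ), ‖f‖ ≤ 1 ∧ f ((σ ^ k) x) = 1 ∧ ∀ j ∈ F, j ≠ k → f ((σ ^ j) x) = 0 := by
  classical
  obtain ⟨g, hg0, hg1, hg⟩ := exists_continuous_zero_one_of_isClosed
    (s := (fun j : ℤ => (σ ^ j) x) '' (F.erase k : Finset ℤ)) (t := {(σ ^ k) x})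
    ((Finset.finite_toSet _).image _).isClosed isClosed_singleton (by
      rw [Set.disjoint_singleton_right]
      rintro ⟨j, hj, h⟩
      exact Finset.ne_of_mem_erase hj (orbit_injective hx h))
  refine ⟨(⟨Complex.ofReal, Complex.continuous_ofReal⟩ : C(ℝ, ℂ)).comp g, ?_, ?_, ?_⟩
  · rw [ContinuousMap.norm_le _ zero_le_one]
    intro y
    simpa [abs_of_nonneg (hg y).1] using (hg y).2
  · simpa using hg1 rfl
  · intro j hj hjk
    simpa using hg0 ⟨j, by simp [hj, hjk], rfl⟩

end Orbit

section Sequences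

variable (p : ℝ≥0∞)

theorem lpSingle_apply_ne (j : ℤ) (c : ℂ) {k : ℤ} (h : k ≠ j) :
    (lp.single p j c : LpZ p) k = 0 :=
  Pi.single_eq_of_ne (M := fun _ : ℤ => ℂ) h c

theorem lpSingle_zero_one_ne_zero : (lp.single p 0 1 : LpZ p) ≠ 0 := by
  intro h
  have h1 : (lp.single p (0 : ℤ) (1 : ℂ) : LpZ p) 0 = 1 := lp.single_apply_self p 0 1
  rw [h] at h1
  exact zero_ne_one h1

theorem exists_apply_ne_zero_of_ne_bot {L : Submodule ℂ (LpZ p)} (hL : L ≠ ⊥) :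
    ∃ v ∈ L, ∃ k, v k ≠ 0 := by
  obtain ⟨v, hv, hv0⟩ := L.exists_mem_ne_zero_of_ne_bot hL
  by_contra! h
  exact hv0 (lp.ext (funext (h v hv)))

end Sequences

/-! ### Matrix entries of the representation and the cyclic subspace of `e_0`. -/

section Rep

variable (p : ℝ≥0∞) [Fact (1 ≤ p)] {X : Type*} [TopologicalSpace X] [CompactSpace X]
  (σ : X ≃ₜ X) (x : X)

theorem rep_apply (a : L1Sigma σ) :
    rep p σ x a = ∑' n : ℤ, mulOp p σ x (a n) * shiftPow p n := rfl

theorem norm_rep_le (a : L1Sigma σ) : ‖rep p σ x a‖ ≤ ‖a‖ := by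
  rw [rep_apply, L1Sigma.norm_def]
  exact (norm_tsum_le_tsum_norm (summable_norm_repTerm p x a)).trans
    ((summable_norm_repTerm p x a).tsum_le_tsum (fun n => norm_repTerm_le p σ x (a n) n)
      a.summable_norm)

theorem rep_single (n : ℤ) (f : C(X, ℂ)) :
    rep p σ x (L1Sigma.single n f) = mulOp p σ x f * shiftPow p n := by
  rw [rep_apply, tsum_eq_single n]
  · rw [L1Sigma.single_apply, if_pos rfl]
  · intro m hm
    rw [L1Sigma.single_apply, if_neg hm, ← repTermCLM_apply, map_zero]

theorem rep_single_zero (f : C(X, ℂ)) :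
    rep p σ x (L1Sigma.single 0 f) = mulOp p σ x f := by
  rw [rep_single]
  ext v k
  simp only [mul_apply_eq_comp, mulOp_apply, shiftPow_apply, sub_zero]

theorem rep_single_one (n : ℤ) :
    rep p σ x (L1Sigma.single n 1) = shiftPow p n := by
  rw [rep_single]
  ext v k
  simp only [mul_apply_eq_comp, mulOp_apply, ContinuousMap.one_apply, one_mul]

theorem rep_one : rep p σ x 1 = 1 := by
  change rep p σ x (L1Sigma.single 0 1) = 1
  rw [rep_single_one]
  ext v k
  rw [shiftPow_apply, sub_zero, one_apply_eq_self]

theorem rep_apply_coe (a : L1Sigma σ) (v : LpZ p) (k : ℤ) :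
    rep p σ x a v k = ∑' n : ℤ, a n ((σ ^ k) x) * v (k - n) := by
  have h := (((summable_repTerm p x a).hasSum.mapL (ContinuousLinearMap.apply ℂ (LpZ p) v)).mapL
    (lp.evalCLM ℂ (fun _ : ℤ => ℂ) p k)).tsum_eq
  refine h.symm.trans (tsum_congr fun n => ?_)
  exact congrArg (a n ((σ ^ k) x) * ·) (shiftPow_apply p n v k)

theorem rep_lpSingle_apply (a : L1Sigma σ) (j : ℤ) (c : ℂ) (k : ℤ) :
    rep p σ x a (lp.single p j c) k = a (k - j) ((σ ^ k) x) * c := by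
  rw [rep_apply_coe, tsum_eq_single (k - j)]
  · rw [sub_sub_cancel, lp.single_apply_self]
  · intro n hn
    rw [lpSingle_apply_ne p j c (by omega), mul_zero]

theorem shiftPow_lpSingle (n j : ℤ) (c : ℂ) :
    shiftPow p n (lp.single p j c) = lp.single p (j + n) c := by
  ext k
  rw [shiftPow_apply, lp.single_apply, lp.single_apply, Pi.single_apply, Pi.single_apply]
  exact if_congr (by omega) rfl rfl

theorem mulOp_lpSingle (f : C(X, ℂ)) (j : ℤ) (c : ℂ) :
    mulOp p σ x f (lp.single p j c) = f ((σ ^ j) x) • lp.single p j c := by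
  ext k
  rw [mulOp_apply, lp.coeFn_smul, Pi.smul_apply, smul_eq_mul]
  rcases eq_or_ne k j with rfl | h
  · rfl
  · rw [lpSingle_apply_ne p j c h, mul_zero, mul_zero]

/-- The orbit map `a ↦ π_x^p(a) e_0` as a linear map. -/
def orbitMap : L1Sigma σ →ₗ[ℂ] LpZ p where
  toFun a := rep p σ x a (lp.single p 0 1)
  map_add' a b := by rw [map_add, _root_.add_apply]
  map_smul' c a := by rw [map_smul, _root_.smul_apply]; rfl

theorem orbitMap_apply (a : L1Sigma σ) : orbitMap p σ x a = rep p σ x a (lp.single p 0 1) := rfl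

theorem orbitMap_one : orbitMap p σ x 1 = lp.single p 0 1 := by
  rw [orbitMap_apply, rep_one, one_apply_eq_self]

theorem isInvariant_range_orbitMap :
    IsInvariant (rep p σ x) (LinearMap.range (orbitMap p σ x)) := by
  rintro a _ ⟨b, rfl⟩
  exact ⟨a * b, by simp only [orbitMap_apply, map_mul, mul_apply_eq_comp]⟩

/-- The bound does not depend on `p`: it places the cyclic subspace in `ℓ^1`, on which both negative
results rest. -/
theorem norm_orbitMap_apply_le (a : L1Sigma σ) (k : ℤ) : ‖orbitMap p σ x a k‖ ≤ ‖a k‖ := by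
  rw [orbitMap_apply, rep_lpSingle_apply, sub_zero, mul_one]
  exact (a k).norm_coe_le_norm _

theorem summable_norm_orbitMap (a : L1Sigma σ) : Summable fun k => ‖orbitMap p σ x a k‖ :=
  a.summable_norm.of_nonneg_of_le (fun _ => norm_nonneg _) (norm_orbitMap_apply_le p σ x a)

theorem range_orbitMap_ne_bot : LinearMap.range (orbitMap p σ x) ≠ ⊥ := fun h =>
  lpSingle_zero_one_ne_zero p ((Submodule.mem_bot ℂ).1 (h ▸ ⟨1, orbitMap_one p σ x⟩))

theorem exists_rep_apply_ne_zero : ∃ (a : L1Sigma σ) (v : LpZ p), rep p σ x a v ≠ 0 :=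
  ⟨1, lp.single p 0 1, by rw [rep_one]; exact lpSingle_zero_one_ne_zero p⟩

theorem mulOp_mem {L : Submodule ℂ (LpZ p)} (hL : IsInvariant (rep p σ x) L) (f : C(X, ℂ))
    {v : LpZ p} (hv : v ∈ L) : mulOp p σ x f v ∈ L := by
  rw [← rep_single_zero]
  exact hL _ v hv

theorem not_isAlgebraicallyIrreducible (h1 : 1 < p) (hp : p < ∞) :
    ¬ IsAlgebraicallyIrreducible (rep p σ x) := by
  rintro ⟨-, h⟩
  have htop := (h _ (isInvariant_range_orbitMap p σ x)).resolve_left (range_orbitMap_ne_bot p σ x)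
  have hreal : 1 < p.toReal := by
    simpa using (ENNReal.toReal_lt_toReal ENNReal.one_ne_top hp.ne).2 h1
  -- The junk value `0⁻¹ = 0` makes the sequence harmless at `k = 0`; it is in `ℓ^p` since `p > 1`,
  -- but it is not summable.
  have hmem : Memℓp (fun k : ℤ => ((k : ℂ))⁻¹) p := by
    refine memℓp_gen ((Real.summable_abs_int_rpow hreal).congr fun k => ?_)
    rw [norm_inv, Complex.norm_intCast, Real.inv_rpow (abs_nonneg _), Real.rpow_neg (abs_nonneg _)]
  obtain ⟨a, ha⟩ : (⟨_, hmem⟩ : LpZ p) ∈ LinearMap.range (orbitMap p σ x) := htop ▸ trivial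
  have hs := summable_norm_orbitMap p σ x a
  rw [ha] at hs
  refine Real.not_summable_one_div_natCast ?_
  refine (hs.comp_injective Nat.cast_injective).congr fun n => ?_
  change ‖(((n : ℤ) : ℂ))⁻¹‖ = _
  simp

theorem not_isTopologicallyIrreducible_top : ¬ IsTopologicallyIrreducible (rep ∞ σ x) := by
  rintro ⟨-, h⟩
  set L := LinearMap.range (orbitMap ∞ σ x) with hLdef
  have hinv : IsInvariant (rep ∞ σ x) L.topologicalClosure := fun a v hv =>
    map_mem_closure (rep ∞ σ x a).continuous hv (isInvariant_range_orbitMap ∞ σ x a)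
  rcases h _ L.isClosed_topologicalClosure hinv with h | h
  · exact range_orbitMap_ne_bot ∞ σ x (le_bot_iff.1 (h ▸ L.le_topologicalClosure))
  · have hmem : Memℓp (fun _ : ℤ => (1 : ℂ)) ∞ := memℓp_infty ⟨1, by rintro _ ⟨k, rfl⟩; simp⟩
    have hcl : (⟨_, hmem⟩ : LpZ ∞) ∈ closure (L : Set (LpZ ∞)) := by
      change _ ∈ L.topologicalClosure
      exact h ▸ trivial
    -- A summable sequence has a coordinate of modulus below `1/2`, so it cannot lie within `1/2` of
    -- the constant sequence `1`.
    obtain ⟨_, ⟨a, rfl⟩, hd⟩ := Metric.mem_closure_iff.1 hcl (1 / 2) (by norm_num)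
    obtain ⟨k, hk⟩ := ((summable_norm_orbitMap ∞ σ x a).tendsto_cofinite_zero.eventually
      (gt_mem_nhds (show (0 : ℝ) < 1 / 2 by norm_num))).exists
    rw [dist_eq_norm] at hd
    have hd' : ‖(1 : ℂ) - orbitMap ∞ σ x a k‖ < 1 / 2 :=
      (lp.norm_apply_le_norm ENNReal.top_ne_zero ((⟨_, hmem⟩ : LpZ ∞) - orbitMap ∞ σ x a) k).trans_lt
        hd
    have := norm_sub_norm_le (1 : ℂ) (orbitMap ∞ σ x a k)
    rw [norm_one] at this
    linarith

/-- Constant functions as coefficients suffice, since they do not see the orbit. The norm bound is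
what later allows a Neumann series. -/
theorem exists_rep_lpSingle_eq (k : ℤ) {c : ℂ} (hc : c ≠ 0) (w : LpZ 1) :
    ∃ b : L1Sigma σ, rep 1 σ x b (lp.single 1 k c) = w ∧ ‖b‖ ≤ ‖w‖ / ‖c‖ := by
  have hw : Summable fun n => ‖w n‖ := by simpa using (lp.memℓp w).summable (by simp)
  have hwn : ‖w‖ = ∑' n, ‖w n‖ := by
    simpa using lp.norm_eq_tsum_rpow (p := 1) (E := fun _ : ℤ => ℂ) (by simp) w
  have hle : ∀ n : ℤ, ‖ContinuousMap.const X (w (n + k) / c)‖ ≤ ‖w (n + k)‖ / ‖c‖ := fun n => by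
    rw [ContinuousMap.norm_le _ (by positivity)]
    intro y
    rw [ContinuousMap.const_apply, norm_div]
  have hs : Summable fun n : ℤ => ‖w (n + k)‖ / ‖c‖ :=
    (hw.comp_injective (Equiv.addRight k).injective).div_const _
  have hsn := hs.of_nonneg_of_le (fun n => norm_nonneg _) hle
  refine ⟨L1Sigma.mk (fun n => ContinuousMap.const X (w (n + k) / c)) hsn, ?_, ?_⟩
  · ext j
    rw [rep_lpSingle_apply, L1Sigma.mk_apply, ContinuousMap.const_apply, sub_add_cancel,
      div_mul_cancel₀ _ hc]
  · rw [L1Sigma.norm_def, hwn, ← tsum_div_const,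
      ← (Equiv.addRight k).tsum_eq fun n => ‖w n‖ / ‖c‖]
    exact hsn.tsum_le_tsum hle hs

/-! ### Isolating a coordinate, and irreducibility for finite `p`. -/

variable {σ x} [T2Space X]

theorem exists_norm_mulOp_sub_lpSingle_lt (hx : x ∉ Function.periodicPts σ) (hp : p ≠ ∞)
    (v : LpZ p) (k : ℤ) {ε : ℝ} (hε : 0 < ε) :
    ∃ f : C(X, ℂ), ‖mulOp p σ x f v - lp.single p k (v k)‖ < ε := by
  classical
  obtain ⟨F, hF⟩ := (Metric.tendsto_atTop.1 (lp.hasSum_single hp v)) ε hε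
  -- Adding `k` ensures that the truncation retains the coordinate to be isolated.
  have hF' := hF (insert k F) (Finset.subset_insert k F)
  obtain ⟨f, hf, hfk, hf0⟩ := exists_norm_le_one_of_finset hx k (insert k F)
  have hsum : mulOp p σ x f (∑ j ∈ insert k F, lp.single p j (v j)) = lp.single p k (v k) := by
    rw [map_sum, Finset.sum_eq_single k]
    · rw [mulOp_lpSingle, hfk, one_smul]
    · intro j hj hjk
      rw [mulOp_lpSingle, hf0 j hj hjk, zero_smul]
    · intro h
      exact absurd (Finset.mem_insert_self k F) h
  refine ⟨f, ?_⟩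
  -- The error is now `π(f)` applied to the tail of `v`. Although `f` depends on the truncation,
  -- `‖f‖ ≤ 1` keeps the tail estimate intact.
  rw [← hsum, ← map_sub]
  rw [dist_comm, dist_eq_norm] at hF'
  refine ((mulOp p σ x f).le_opNorm _).trans_lt (lt_of_le_of_lt ?_ hF')
  exact mul_le_of_le_one_left (norm_nonneg _) ((norm_mulOp_le p σ x f).trans hf)

theorem isAlgebraicallyIrreducible_one (hx : x ∉ Function.periodicPts σ) :
    IsAlgebraicallyIrreducible (rep 1 σ x) := by
  refine ⟨exists_rep_apply_ne_zero 1 σ x, fun L hL => or_iff_not_imp_left.2 fun hbot => ?_⟩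
  obtain ⟨v, hv, k, hk⟩ := exists_apply_ne_zero_of_ne_bot 1 hbot
  -- The tolerance `‖v k‖` is exactly what makes `‖b‖ < 1` below.
  obtain ⟨f, hf⟩ := exists_norm_mulOp_sub_lpSingle_lt 1 hx ENNReal.one_ne_top v k
    (norm_pos_iff.2 hk)
  obtain ⟨b, hb, hbn⟩ := exists_rep_lpSingle_eq σ x k hk
    (mulOp 1 σ x f v - lp.single 1 k (v k))
  have hb1 : ‖-b‖ < 1 := by
    rw [norm_neg]
    exact hbn.trans_lt ((div_lt_one (norm_pos_iff.2 hk)).2 hf)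
  -- Here `u = 1 + b`, so `π(u)` maps `v_k e_k` to `π(f) v ∈ L`, and applying `π(u⁻¹)` brings `v_k
  -- e_k` itself into `L`.
  set u := Units.oneSub (-b) hb1 with hu
  have hue : rep 1 σ x (u : L1Sigma σ) (lp.single 1 k (v k)) = mulOp 1 σ x f v := by
    rw [hu, Units.val_oneSub, sub_neg_eq_add, map_add, rep_one, _root_.add_apply, hb,
      one_apply_eq_self, add_sub_cancel]
  have he : lp.single 1 k (v k) ∈ L := by
    have h := hL (↑u⁻¹) _ (mulOp_mem 1 σ x hL f hv)
    rwa [← hue, ← mul_apply_eq_comp, ← map_mul, Units.inv_mul, rep_one, one_apply_eq_self] at h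
  refine eq_top_iff.2 fun w _ => ?_
  obtain ⟨a, rfl, -⟩ := exists_rep_lpSingle_eq σ x k hk w
  exact hL a _ he

theorem isTopologicallyIrreducible (hx : x ∉ Function.periodicPts σ) (hp : p ≠ ∞) :
    IsTopologicallyIrreducible (rep p σ x) := by
  refine ⟨exists_rep_apply_ne_zero p σ x, fun L hcl hL => or_iff_not_imp_left.2 fun hbot => ?_⟩
  obtain ⟨v, hv, k, hk⟩ := exists_apply_ne_zero_of_ne_bot p hbot
  have he : lp.single p k (v k) ∈ L := by
    refine hcl.closure_subset (Metric.mem_closure_iff.2 fun ε hε => ?_)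
    obtain ⟨f, hf⟩ := exists_norm_mulOp_sub_lpSingle_lt p hx hp v k hε
    exact ⟨_, mulOp_mem p σ x hL f hv, by rwa [dist_comm, dist_eq_norm]⟩
  refine eq_top_iff.2 fun w _ => hcl.mem_of_tendsto (lp.hasSum_single hp w)
    (Filter.Eventually.of_forall fun F => L.sum_mem fun j _ => ?_)
  -- Shifting by `j - k` and rescaling turns `v_k e_k` into `w_j e_j`.
  have h := L.smul_mem (w j / v k) (hL (L1Sigma.single (j - k) 1) _ he)
  rwa [rep_single_one, shiftPow_lpSingle, add_sub_cancel, ← lp.single_smul, smul_eq_mul,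
    div_mul_cancel₀ _ hk] at h

/-! ### The commutant. -/

theorem centralizer_range_rep (hx : x ∉ Function.periodicPts σ) (hp : p ≠ ∞) :
    Set.centralizer (Set.range (rep p σ x)) =
      Set.range fun c : ℂ => c • (1 : LpZ p →L[ℂ] LpZ p) := by
  refine Set.Subset.antisymm (fun T hT => ?_) ?_
  · have hcomm : ∀ (a : L1Sigma σ) (v : LpZ p), rep p σ x a (T v) = T (rep p σ x a v) :=
      fun a v => DFunLike.congr_fun (Set.mem_centralizer_iff.1 hT _ ⟨a, rfl⟩) v
    set w := T (lp.single p 0 1) with hw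
    -- If `f` is `1` at `x` and `0` at `σ ^ k x`, then `T e_0 = T π(f) e_0 = π(f) T e_0`, whose
    -- `k`-th coordinate vanishes.
    have hw0 : ∀ k : ℤ, k ≠ 0 → w k = 0 := fun k hk => by
      obtain ⟨f, -, hf1, hf0⟩ := exists_norm_le_one_of_finset hx 0 {k}
      have h := hcomm (L1Sigma.single 0 f) (lp.single p 0 1)
      rw [rep_single_zero, mulOp_lpSingle, hf1, one_smul] at h
      have hk' := congrArg (fun v : LpZ p => v k) h
      simp only [mulOp_apply, hf0 k (Finset.mem_singleton_self k) hk, zero_mul] at hk'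
      exact hk'.symm
    have hwe : w = w 0 • lp.single p 0 1 := by
      ext k
      rw [lp.coeFn_smul, Pi.smul_apply, smul_eq_mul]
      rcases eq_or_ne k 0 with rfl | hk
      · rw [lp.single_apply_self, mul_one]
      · rw [hw0 k hk, lpSingle_apply_ne p 0 1 hk, mul_zero]
    -- For `p < ∞` a bounded operator is determined by its values on the `e_j`; commutation with `S
    -- ^ j` reduces these to `T e_0`.
    refine ⟨w 0, (lp.ext_continuousLinearMap hp fun j => ?_).symm⟩
    ext1
    change T (lp.single p j 1) = w 0 • lp.single p j 1
    have h := hcomm (L1Sigma.single j 1) (lp.single p 0 1)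
    rw [rep_single_one, shiftPow_lpSingle, zero_add, ← hw] at h
    rw [← h, hwe, map_smul, shiftPow_lpSingle, zero_add, ← hwe]
  · rintro _ ⟨c, rfl⟩
    rw [Set.mem_centralizer_iff]
    intro T _
    rw [mul_smul_comm, smul_mul_assoc, mul_one, one_mul]

end Rep

end DynSys

end

theorem mainTheorem2 {X : Type*} [TopologicalSpace X] [CompactSpace X] [T2Space X]
    (σ : X ≃ₜ X) (x : X) (hx : x ∉ Function.periodicPts σ)
    (p : ℝ≥0∞) [Fact (1 ≤ p)] :
    (DynSys.rep p σ x 1 = 1 ∧ ∀ a : DynSys.L1Sigma σ, ‖DynSys.rep p σ x a‖ ≤ ‖a‖) ∧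
    (p = 1 → DynSys.IsAlgebraicallyIrreducible (DynSys.rep p σ x)) ∧
    (1 < p → p < ∞ → ¬ DynSys.IsAlgebraicallyIrreducible (DynSys.rep p σ x) ∧
      DynSys.IsTopologicallyIrreducible (DynSys.rep p σ x)) ∧
    (p = ∞ → ¬ DynSys.IsTopologicallyIrreducible (DynSys.rep p σ x)) ∧
    (p < ∞ → Set.centralizer (Set.range (DynSys.rep p σ x)) =
      Set.range fun c : ℂ => c • (1 : DynSys.LpZ p →L[ℂ] DynSys.LpZ p)) := by
  refine ⟨⟨DynSys.rep_one p σ x, DynSys.norm_rep_le p σ x⟩, ?_, fun h1 hp =>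
    ⟨DynSys.not_isAlgebraicallyIrreducible p σ x h1 hp,
      DynSys.isTopologicallyIrreducible p hx hp.ne⟩, ?_, fun hp =>
    DynSys.centralizer_range_rep p hx hp.ne⟩
  · rintro rfl
    exact DynSys.isAlgebraicallyIrreducible_one hx
  · rintro rfl
    exact DynSys.not_isTopologicallyIrreducible_top σ x
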